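/- Let $X$ be a compact Hausdorff space and let $A$ and $B$ be $C(X)$-algebras, that is, (not necessarily unital) C*-algebras each endowed with a unital $*$-homomorphism from $C(X)$ into the center of its multiplier algebra; for $f \in C(X)$ and $a \in A$ write $fa \in A$ for the action of $f$ as a multiplier on $a$, and similarly for $B$. For $x \in X$ let $A_x$ be the quotient of $A$ by the closed ideal $C_x(X)A$, the closed linear span of the elements $fa$ with $a \in A$, $f \in C(X)$ and $f(x)=0$; define $B_x$ likewise. Let $A \otimes_{alg} B$ be the algebraic tensor product over $\mathbb{C}$, with its usual $*$-algebra structure, and for $\alpha \in A \otimes_{alg} B$ let $\alpha_x$ be its image in $A_x \otimes_{alg} B_x$. Let $\mathcal{I}(A,B)$ be the involutive (two-sided, $*$-stable) ideal of $A \otimes_{alg} B$ generated by the elements $(fa)\otimes b - a\otimes(fb)$ with $f \in C(X)$, $a \in A$, $b \in B$, and let $$\mathcal{J}(A,B) = \{\alpha \in A\otimes_{alg} B : \alpha_x = 0 \text{ in } A_x\otimes_{alg} B_x \text{ for every } x \in X\},$$ an involutive ideal which contains $\mathcal{I}(A,B)$. Let $\|\cdot\|_\beta$ be a C*-semi-norm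 on $A\otimes_{alg} B$, that is, a submultiplicative semi-norm with $\|\alpha^*\alpha\|_\beta = \|\alpha\|_\beta^2$ for all $\alpha \in A\otimes_{alg} B$. If $\|\alpha\|_\beta = 0$ for all $\alpha \in \mathcal{I}(A,B)$, then $\|\alpha\|_\beta = 0$ for all $\alpha \in \mathcal{J}(A,B)$. -/

import Mathlib

open scoped TensorProduct MultiplierAlgebra

noncomputable section

namespace CXTensor

/-- A subset of a complex `*`-algebra `C` (not necessarily unital) is an *involutive ideal* if it is
a linear subspace, absorbs multiplication on both sides, and is stable under the involution. -/
structure IsInvolutiveIdeal {C : Type*} [NonUnitalRing C] [StarRing C] [Module ℂ C]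
    (I : Submodule ℂ C) : Prop where
  mul_left : ∀ c : C, ∀ d ∈ I, c * d ∈ I
  mul_right : ∀ c : C, ∀ d ∈ I, d * c ∈ I
  star_mem : ∀ d ∈ I, star d ∈ I

/-- The involutive ideal generated by a set: the smallest involutive ideal containing it. -/
def involutiveIdealSpan {C : Type*} [NonUnitalRing C] [StarRing C] [Module ℂ C]
    (S : Set C) : Submodule ℂ C :=
  sInf {I : Submodule ℂ C | IsInvolutiveIdeal I ∧ S ⊆ I}

theorem involutiveIdealSpan_isInvolutiveIdeal {C : Type*} [NonUnitalRing C] [StarRing C]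
    [Module ℂ C] (S : Set C) : IsInvolutiveIdeal (involutiveIdealSpan S) where
  mul_left c d hd := by
    simp only [involutiveIdealSpan, Submodule.mem_sInf] at hd ⊢
    exact fun I hI => hI.1.mul_left c d (hd I hI)
  mul_right c d hd := by
    simp only [involutiveIdealSpan, Submodule.mem_sInf] at hd ⊢
    exact fun I hI => hI.1.mul_right c d (hd I hI)
  star_mem d hd := by
    simp only [involutiveIdealSpan, Submodule.mem_sInf] at hd ⊢
    exact fun I hI => hI.1.star_mem d (hd I hI)

theorem subset_involutiveIdealSpan {C : Type*} [NonUnitalRing C] [StarRing C]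
    [Module ℂ C] (S : Set C) : S ⊆ involutiveIdealSpan S := by
  intro s hs
  simp only [involutiveIdealSpan, SetLike.mem_coe, Submodule.mem_sInf]
  exact fun I hI => hI.2 hs

/-- A C⋆-semi-norm on a complex `*`-algebra `C`: a submultiplicative semi-norm satisfying the
C⋆-identity. -/
structure IsCStarSeminorm {C : Type*} [NonUnitalRing C] [StarRing C] [Module ℂ C]
    (p : Seminorm ℂ C) : Prop where
  mul_le : ∀ c d : C, p (c * d) ≤ p c * p d
  star_mul_self : ∀ c : C, p (star c * c) = p c ^ 2

/-- A `C(X)`-algebra: a (not necessarily unital) C⋆-algebra `A` together with a unital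
`*`-homomorphism from `C(X)` into the center of the multiplier algebra of `A`. -/
class CXAlgebra (X : Type*) [TopologicalSpace X] [CompactSpace X]
    (A : Type*) [NonUnitalCStarAlgebra A] where
  structureMap : C(X, ℂ) →⋆ₐ[ℂ] 𝓜(ℂ, A)
  structureMap_mem_center : ∀ f : C(X, ℂ), structureMap f ∈ Subalgebra.center ℂ 𝓜(ℂ, A)

section Fibre

variable {X : Type*} [TopologicalSpace X] [CompactSpace X]
variable {A : Type*} [NonUnitalCStarAlgebra A] [CXAlgebra X A]

/-- The product `f a ∈ A` of `f ∈ C(X)` and `a ∈ A`: the multiplier given by `f`, applied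
to `a`. -/
def act (f : C(X, ℂ)) (a : A) : A :=
  (CXAlgebra.structureMap f : 𝓜(ℂ, A)).fst a

theorem act_mul (f : C(X, ℂ)) (a b : A) : act f (a * b) = act f a * b := by
  have key : ∀ c : A, c * (act f (a * b) - act f a * b) = 0 := fun c => by
    rw [mul_sub, ← mul_assoc, act, act, ← DoubleCentralizer.central,
      ← DoubleCentralizer.central, mul_assoc, sub_self]
  have h := key (star (act f (a * b) - act f a * b))
  exact sub_eq_zero.1 (CStarRing.star_mul_self_eq_zero_iff _ |>.1 h)

theorem act_eq_snd (f : C(X, ℂ)) (a : A) :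
    act f a = (CXAlgebra.structureMap f : 𝓜(ℂ, A)).snd a := by
  have key : ∀ b : A,
      (act f a - (CXAlgebra.structureMap f : 𝓜(ℂ, A)).snd a) * b = 0 := fun b => by
    have h := Subalgebra.mem_center_iff.1
      (CXAlgebra.structureMap_mem_center (A := A) f) (a : 𝓜(ℂ, A))
    have h2 := DFunLike.congr_fun (congrArg (fun m : 𝓜(ℂ, A) => m.fst) h) b
    simp only [DoubleCentralizer.mul_fst, DoubleCentralizer.coe_fst,
      mul_apply_eq_comp, ContinuousLinearMap.mul_apply'] at h2
    rw [sub_mul, ← act_mul, DoubleCentralizer.central, act, h2, sub_self]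
  have h := key (star (act f a - (CXAlgebra.structureMap f : 𝓜(ℂ, A)).snd a))
  exact sub_eq_zero.1 (CStarRing.mul_star_self_eq_zero_iff _ |>.1 h)

theorem mul_act (f : C(X, ℂ)) (a b : A) : act f (a * b) = a * act f b := by
  have h := DFunLike.congr_fun (congrArg (fun m : 𝓜(ℂ, A) => m.fst)
    (Subalgebra.mem_center_iff.1 (CXAlgebra.structureMap_mem_center (A := A) f) (a : 𝓜(ℂ, A)))) b
  simpa [act] using h.symm

theorem star_act (f : C(X, ℂ)) (a : A) : star (act f a) = act (star f) (star a) := by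
  have h : (CXAlgebra.structureMap (star f) : 𝓜(ℂ, A)) = star (CXAlgebra.structureMap f) :=
    map_star _ f
  rw [act_eq_snd (star f), h, DoubleCentralizer.star_snd, star_star, act]

variable (A) in
/-- The closed ideal `C_x(X) A` of `A`, where `C_x(X)` is the ideal of the functions vanishing
at `x`: the closed linear span of the products `f a` with `f(x) = 0` and `a ∈ A`. -/
def fibreIdeal (x : X) : Submodule ℂ A :=
  (Submodule.span ℂ {c : A | ∃ f : C(X, ℂ), f x = 0 ∧ ∃ a : A, c = act f a}).topologicalClosure

theorem fibreIdeal_isInvolutiveIdeal (x : X) : IsInvolutiveIdeal (fibreIdeal A x) := by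
  have aux : ∀ T : A → A, Continuous T → (∀ a b, T (a + b) = T a + T b) →
      (∀ (z : ℂ) a, T (z • a) = z • T a ∨ T (z • a) = star z • T a) →
      (∀ (f : C(X, ℂ)) a, f x = 0 → ∃ (g : C(X, ℂ)) (b : A), g x = 0 ∧ T (act f a) = act g b) →
      ∀ d ∈ fibreIdeal A x, T d ∈ fibreIdeal A x := by
    intro T hT hadd hsmul hact d hd
    refine map_mem_closure hT hd fun c hc => ?_
    refine Submodule.span_induction (p := fun c _ => T c ∈ Submodule.span ℂ _) ?_ ?_ ?_ ?_ hc
    · rintro c ⟨f, hf, a, rfl⟩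
      obtain ⟨g, b, hg, h⟩ := hact f a hf
      exact Submodule.subset_span ⟨g, hg, b, h⟩
    · have h0 : T 0 = 0 := by simpa using hadd 0 0
      rw [h0]
      exact Submodule.zero_mem _
    · intro a b _ _ ha hb
      rw [hadd]
      exact Submodule.add_mem _ ha hb
    · intro z a _ ha
      rcases hsmul z a with h | h <;> rw [h] <;> exact Submodule.smul_mem _ _ ha
  refine ⟨fun c => aux (fun d => c * d) (by fun_prop) (mul_add c) (fun z a => ?_) fun f a hf => ?_,
    fun c => aux (fun d => d * c) (by fun_prop) (fun a b => add_mul a b c) (fun z a => ?_)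
      fun f a hf => ?_, aux star continuous_star star_add (fun z a => ?_) fun f a hf => ?_⟩
  · exact Or.inl (mul_smul_comm z c a)
  · exact ⟨f, c * a, hf, (mul_act f c a).symm⟩
  · exact Or.inl (smul_mul_assoc z a c)
  · exact ⟨f, a * c, hf, (act_mul f a c).symm⟩
  · exact Or.inr (star_smul z a)
  · exact ⟨star f, star a, by simp [hf], star_act f a⟩

variable (A) in
/-- The fibre `A_x = A / C_x(X) A`. (Only its structure of complex vector space matters for the
algebraic tensor product `A_x ⊗ B_x` over `ℂ` of two fibres.) -/
abbrev Fibre (x : X) : Type _ := A ⧸ fibreIdeal A x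

theorem mkQ_act (x : X) (f : C(X, ℂ)) (a : A) :
    (fibreIdeal A x).mkQ (act f a) = f x • (fibreIdeal A x).mkQ a := by
  rw [← map_smul, ← sub_eq_zero, ← map_sub, Submodule.mkQ_apply, Submodule.Quotient.mk_eq_zero]
  refine Submodule.le_topologicalClosure _ (Submodule.subset_span
    ⟨f - algebraMap ℂ C(X, ℂ) (f x), by simp, a, ?_⟩)
  simp only [act, map_sub, AlgHomClass.commutes, DoubleCentralizer.sub_fst,
    DoubleCentralizer.algebraMap_fst, sub_apply]
  rfl

end Fibre

section Ideals

variable (X : Type*) [TopologicalSpace X] [CompactSpace X]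
variable (A : Type*) [NonUnitalCStarAlgebra A] [CXAlgebra X A]
variable (B : Type*) [NonUnitalCStarAlgebra B] [CXAlgebra X B]

/-- The involutive ideal `I(A, B)` of `A ⊗ B` generated by the elements
`(f a) ⊗ b - a ⊗ (f b)`. -/
def idealI : Submodule ℂ (A ⊗[ℂ] B) :=
  involutiveIdealSpan
    {t : A ⊗[ℂ] B | ∃ (f : C(X, ℂ)) (a : A) (b : B), t = act f a ⊗ₜ[ℂ] b - a ⊗ₜ[ℂ] act f b}

variable {X} in
/-- The canonical map `α ↦ α_x` from `A ⊗ B` to `A_x ⊗ B_x`. -/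
def fibreMap (x : X) : A ⊗[ℂ] B →ₗ[ℂ] Fibre A x ⊗[ℂ] Fibre B x :=
  TensorProduct.map (fibreIdeal A x).mkQ (fibreIdeal B x).mkQ

/-- The ideal `J(A, B)` of the elements `α ∈ A ⊗ B` such that `α_x = 0` in `A_x ⊗ B_x` for every
`x ∈ X`. -/
def idealJ : Submodule ℂ (A ⊗[ℂ] B) :=
  ⨅ x : X, LinearMap.ker (fibreMap A B x)

theorem mem_idealJ {α : A ⊗[ℂ] B} : α ∈ idealJ X A B ↔ ∀ x : X, fibreMap A B x α = 0 := by
  simp [idealJ]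

theorem idealJ_isInvolutiveIdeal : IsInvolutiveIdeal (idealJ X A B) := by
  have hA := fun x : X => fibreIdeal_isInvolutiveIdeal (A := A) x
  have hB := fun x : X => fibreIdeal_isInvolutiveIdeal (A := B) x
  refine ⟨fun c d hd => ?_, fun c d hd => ?_, fun d hd => ?_⟩
  · induction c using TensorProduct.induction_on with
    | zero => rw [zero_mul]; exact Submodule.zero_mem _
    | add c₁ c₂ h₁ h₂ => rw [add_mul]; exact Submodule.add_mem _ h₁ h₂
    | tmul a b =>
      rw [mem_idealJ] at hd ⊢
      intro x
      have h : ∀ d : A ⊗[ℂ] B, fibreMap A B x (a ⊗ₜ[ℂ] b * d) =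
          TensorProduct.map
            ((fibreIdeal A x).mapQ (fibreIdeal A x) (LinearMap.mulLeft ℂ a) fun m hm => (hA x).mul_left a m hm)
            ((fibreIdeal B x).mapQ (fibreIdeal B x) (LinearMap.mulLeft ℂ b) fun m hm => (hB x).mul_left b m hm)
            (fibreMap A B x d) := fun d => by
        induction d using TensorProduct.induction_on with
        | zero => simp
        | add d₁ d₂ h₁ h₂ => rw [mul_add, map_add, map_add, map_add, h₁, h₂]
        | tmul a' b' => rw [Algebra.TensorProduct.tmul_mul_tmul]; rfl
      rw [h, hd x, map_zero]
  · induction c using TensorProduct.induction_on with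
    | zero => rw [mul_zero]; exact Submodule.zero_mem _
    | add c₁ c₂ h₁ h₂ => rw [mul_add]; exact Submodule.add_mem _ h₁ h₂
    | tmul a b =>
      rw [mem_idealJ] at hd ⊢
      intro x
      have h : ∀ d : A ⊗[ℂ] B, fibreMap A B x (d * a ⊗ₜ[ℂ] b) =
          TensorProduct.map
            ((fibreIdeal A x).mapQ (fibreIdeal A x) (LinearMap.mulRight ℂ a) fun m hm => (hA x).mul_right a m hm)
            ((fibreIdeal B x).mapQ (fibreIdeal B x) (LinearMap.mulRight ℂ b) fun m hm => (hB x).mul_right b m hm)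
            (fibreMap A B x d) := fun d => by
        induction d using TensorProduct.induction_on with
        | zero => simp
        | add d₁ d₂ h₁ h₂ => rw [add_mul, map_add, map_add, map_add, h₁, h₂]
        | tmul a' b' => rw [Algebra.TensorProduct.tmul_mul_tmul]; rfl
      rw [h, hd x, map_zero]
  · rw [mem_idealJ] at hd ⊢
    intro x
    have h : ∀ d : A ⊗[ℂ] B, fibreMap A B x (star d) =
        TensorProduct.map
          ((fibreIdeal A x).mapQ (fibreIdeal A x) (starLinearEquiv ℂ (A := A)).toLinearMap
            fun m hm => (hA x).star_mem m hm)
          ((fibreIdeal B x).mapQ (fibreIdeal B x) (starLinearEquiv ℂ (A := B)).toLinearMap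
            fun m hm => (hB x).star_mem m hm)
          (fibreMap A B x d) := fun d => by
      induction d using TensorProduct.induction_on with
      | zero => simp
      | add d₁ d₂ h₁ h₂ => rw [star_add, map_add, map_add, map_add, h₁, h₂]
      | tmul a' b' => rfl
    rw [h, hd x, map_zero]

theorem idealI_le_idealJ : idealI X A B ≤ idealJ X A B := by
  refine sInf_le ⟨idealJ_isInvolutiveIdeal X A B, ?_⟩
  rintro _ ⟨f, a, b, rfl⟩
  rw [SetLike.mem_coe, mem_idealJ]
  intro x
  have hA := mkQ_act x f a
  have hB := mkQ_act x f b
  simp only [fibreMap, map_sub, TensorProduct.map_tmul, hA, hB, TensorProduct.smul_tmul, sub_self]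

end Ideals

end CXTensor

end

/-! The argument localises over `X`. Multipliers of `A` act on `A ⊗ B` with `p (m t) ≤ ‖m‖ * p t`,
although `p` is not assumed to be a cross norm, so `C(X)` acts contractively through the first
factor.

If `α_x = 0`, then `α` lies in `C_x(X)A ⊗ B + A ⊗ C_x(X)B`. Cutting off by a function equal to `1`
near `x` makes each summand small for `p`; on the second summand, vanishing on `I(A, B)` moves the
cutoff across the tensor sign (`exists_isCutoffAt_leftActHom_lt`).

Let `t` be self-adjoint and locally below `ε`. Compactness gives `∑ f i = 1` with `f i * g i = f i`
and `p (g i t) < ε`. Then `t ^ N = ∑ f i (g i t) ^ N`, hence `p t ^ N ≤ n * ε ^ N` for `N = 2 ^ k`,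
with `n` independent of `k`; letting `k` grow gives `p t ≤ ε` (`apply_le_of_isCutoffAt`). The
theorem follows with `t = star α * α`. -/

open scoped TensorProduct MultiplierAlgebra

noncomputable section

namespace CXTensor

/-! ### Cutoff functions and partitions of unity -/

section LocallySmall

variable {X : Type*} [TopologicalSpace X] [CompactSpace X]
variable {E : Type*} [AddCommGroup E] [Module ℂ E]

/-- A function in the unit ball of `C(X)` which is equal to `1` near `x`. -/
structure IsCutoffAt (x : X) (g : C(X, ℂ)) : Prop where
  norm_le : ‖g‖ ≤ 1
  eventually_eq_one : ∀ᶠ y in nhds x, g y = 1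

theorem IsCutoffAt.one (x : X) : IsCutoffAt x (1 : C(X, ℂ)) :=
  ⟨(ContinuousMap.norm_le _ zero_le_one).2 fun _ => by simp, by simp⟩

theorem IsCutoffAt.mul {x : X} {g h : C(X, ℂ)} (hg : IsCutoffAt x g) (hh : IsCutoffAt x h) :
    IsCutoffAt x (g * h) where
  norm_le := (norm_mul_le g h).trans (mul_le_one₀ hg.norm_le (norm_nonneg _) hh.norm_le)
  eventually_eq_one := by
    filter_upwards [hg.eventually_eq_one, hh.eventually_eq_one] with y h₁ h₂
    simp [h₁, h₂]

theorem exists_isCutoffAt_norm_mul_le [T2Space X] {x : X} {f : C(X, ℂ)} (hf : f x = 0)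
    {ε : ℝ} (hε : 0 < ε) : ∃ g : C(X, ℂ), IsCutoffAt x g ∧ ‖g * f‖ ≤ ε := by
  have hs : IsClosed {y | ε ≤ ‖f y‖} := isClosed_le continuous_const (by fun_prop)
  have ht : IsClosed {y | ‖f y‖ ≤ ε / 2} := isClosed_le (by fun_prop) continuous_const
  have hd : Disjoint {y | ε ≤ ‖f y‖} {y | ‖f y‖ ≤ ε / 2} :=
    Set.disjoint_left.2 fun y (h₁ : ε ≤ ‖f y‖) (h₂ : ‖f y‖ ≤ ε / 2) => by linarith
  obtain ⟨g, hg0, hg1, hg⟩ := exists_continuous_zero_one_of_isClosed hs ht hd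
  have hnorm : ∀ y, ‖(g y : ℂ)‖ ≤ 1 := fun y => by
    rw [Complex.norm_real, Real.norm_of_nonneg (hg y).1]
    exact (hg y).2
  refine ⟨⟨fun y => (g y : ℂ), by fun_prop⟩, ⟨?_, ?_⟩, ?_⟩
  · exact (ContinuousMap.norm_le _ zero_le_one).2 hnorm
  · have : ∀ᶠ y in nhds x, ‖f y‖ < ε / 2 :=
      (by fun_prop : Continuous fun y => ‖f y‖).continuousAt.eventually_lt
        continuousAt_const (by simpa [hf] using hε)
    filter_upwards [this] with y hy
    simp [hg1 (show y ∈ {y | ‖f y‖ ≤ ε / 2} from hy.le)]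
  · refine (ContinuousMap.norm_le _ hε.le).2 fun y => ?_
    rw [ContinuousMap.mul_apply, ContinuousMap.coe_mk, norm_mul]
    rcases le_total ε ‖f y‖ with h | h
    · simp [hg0 (show y ∈ {y | ε ≤ ‖f y‖} from h), hε.le]
    · exact (mul_le_mul (hnorm y) h (norm_nonneg _) zero_le_one).trans (one_mul ε).le

variable (T : C(X, ℂ) →ₐ[ℂ] Module.End ℂ E) (q : Seminorm ℂ E)

/-- The vectors which are made arbitrarily small, for the semi-norm `q`, by cutting off at `x`. -/
def locallySmall (hT : ∀ f e, q (T f e) ≤ ‖f‖ * q e) (x : X) : Submodule ℂ E where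
  carrier := {e | ∀ ε > 0, ∃ g, IsCutoffAt x g ∧ q (T g e) < ε}
  zero_mem' := fun ε hε => ⟨1, .one x, by simpa using hε⟩
  add_mem' := by
    intro d e hd he ε hε
    obtain ⟨g, hg, hgd⟩ := hd (ε / 2) (half_pos hε)
    obtain ⟨h, hh, hhe⟩ := he (ε / 2) (half_pos hε)
    have key : ∀ {g : C(X, ℂ)} (_ : IsCutoffAt x g) (e : E), q (T g e) ≤ q e := fun hg e =>
      (hT _ e).trans (mul_le_of_le_one_left (apply_nonneg q e) hg.norm_le)
    refine ⟨g * h, hg.mul hh, ?_⟩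
    rw [map_add]
    refine (map_add_le_add q _ _).trans_lt ?_
    have h₁ : q (T (g * h) d) ≤ q (T g d) := by
      rw [mul_comm, map_mul, Module.End.mul_apply]
      exact key hh _
    have h₂ : q (T (g * h) e) ≤ q (T h e) := by
      rw [map_mul, Module.End.mul_apply]
      exact key hg _
    linarith
  smul_mem' := by
    intro z e he ε hε
    obtain ⟨g, hg, hge⟩ := he (ε / (‖z‖ + 1)) (by positivity)
    refine ⟨g, hg, ?_⟩
    rw [map_smul, map_smul_eq_mul]
    calc ‖z‖ * q (T g e) ≤ (‖z‖ + 1) * q (T g e) := by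
          gcongr
          linarith
      _ < ε := by rwa [mul_comm, ← lt_div_iff₀ (by positivity)]

variable {T q} {hT : ∀ f e, q (T f e) ≤ ‖f‖ * q e} {x : X}

theorem apply_mem_locallySmall [T2Space X] {f : C(X, ℂ)} (hf : f x = 0) (e : E) :
    T f e ∈ locallySmall T q hT x := by
  intro ε hε
  have hq : 0 ≤ q e := apply_nonneg q e
  -- The `+ 1` covers the case `q e = 0`.
  obtain ⟨g, hg, hgf⟩ := exists_isCutoffAt_norm_mul_le hf
    (show 0 < ε / (q e + 1) by positivity)
  refine ⟨g, hg, ?_⟩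
  rw [← Module.End.mul_apply, ← map_mul]
  calc q (T (g * f) e) ≤ ‖g * f‖ * q e := hT _ _
    _ ≤ ε / (q e + 1) * q e := by gcongr
    _ < ε / (q e + 1) * (q e + 1) := by gcongr; linarith
    _ = ε := by field_simp

theorem mem_locallySmall_of_approx {e : E}
    (he : ∀ ε > 0, ∃ d ∈ locallySmall T q hT x, q (e - d) < ε) :
    e ∈ locallySmall T q hT x := by
  intro ε hε
  obtain ⟨d, hd, hed⟩ := he (ε / 2) (half_pos hε)
  obtain ⟨g, hg, hgd⟩ := hd (ε / 2) (half_pos hε)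
  refine ⟨g, hg, ?_⟩
  have h₁ : q (T g (e - d)) ≤ q (e - d) :=
    (hT _ _).trans (mul_le_of_le_one_left (apply_nonneg q _) hg.norm_le)
  have h₂ : q (T g e) ≤ q (T g (e - d)) + q (T g d) := by
    simpa using map_add_le_add q (T g (e - d)) (T g d)
  linarith

/-- If every point of `X` has a cutoff in `G`, then `1` is a finite sum of functions in the unit
ball of `C(X)`, each of which is fixed by multiplication by some element of `G`. -/
theorem exists_sum_eq_one_of_isCutoffAt [T2Space X] (G : Set C(X, ℂ))
    (hG : ∀ x : X, ∃ g ∈ G, IsCutoffAt x g) :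
    ∃ (s : Finset X) (f g : s → C(X, ℂ)), ∑ i, f i = 1 ∧
      ∀ i, ‖f i‖ ≤ 1 ∧ g i ∈ G ∧ f i * g i = f i := by
  choose g hgG hg using hG
  obtain ⟨s, hs⟩ := isCompact_univ.elim_finite_subcover
    (fun x => interior {y | g x y = 1}) (fun _ => isOpen_interior) fun x _ =>
      Set.mem_iUnion.2 ⟨x, mem_interior_iff_mem_nhds.2 (hg x).eventually_eq_one⟩
  obtain ⟨ρ, hρ⟩ := PartitionOfUnity.exists_isSubordinate isClosed_univ
    (fun i : s => interior {y | g i y = 1}) (fun _ => isOpen_interior) (by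
      intro y hy
      obtain ⟨x, hx, hy⟩ := Set.mem_iUnion₂.1 (hs hy)
      exact Set.mem_iUnion.2 ⟨⟨x, hx⟩, hy⟩)
  refine ⟨s, fun i => ⟨fun y => (ρ i y : ℂ), by fun_prop⟩, fun i => g i, ?_,
    fun i => ⟨?_, hgG i, ?_⟩⟩
  · ext y
    have := ρ.sum_eq_one (Set.mem_univ y)
    rw [finsum_eq_sum_of_fintype] at this
    simpa [ContinuousMap.sum_apply, ← Complex.ofReal_sum] using this
  · refine (ContinuousMap.norm_le _ zero_le_one).2 fun y => ?_
    rw [ContinuousMap.coe_mk, Complex.norm_real, Real.norm_of_nonneg (ρ.nonneg i y)]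
    exact ρ.le_one i y
  · ext y
    by_cases hy : ρ i y = 0
    · simp [hy]
    -- Subordination puts the support of `ρ i` where the cutoff is exactly `1`.
    · have : y ∈ {y | g i y = 1} := interior_subset (hρ i (subset_closure hy))
      simp [this.out]

end LocallySmall

/-! ### C⋆-semi-norms and unitaries -/

namespace IsCStarSeminorm

variable {C : Type*} [NonUnitalRing C] [StarRing C] [Module ℂ C] {p : Seminorm ℂ C}

theorem apply_star (hp : IsCStarSeminorm p) (c : C) : p (star c) = p c := by
  have aux : ∀ c, p c ≤ p (star c) := fun c => by
    by_contra! h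
    have h₁ := hp.mul_le (star c) c
    rw [hp.star_mul_self] at h₁
    nlinarith [apply_nonneg p (star c)]
  exact le_antisymm (by simpa using aux (star c)) (aux c)

end IsCStarSeminorm

/-- The unitary is `m + i √(1 - m²)`. -/
theorem exists_unitary_two_smul_eq_add_star {C : Type*} [CStarAlgebra C] {m : C}
    (hm : IsSelfAdjoint m) (h1 : ‖m‖ ≤ 1) : ∃ u ∈ unitary C, (2 : ℂ) • m = u + star u := by
  let _ := CStarAlgebra.spectralOrder C
  have _ := CStarAlgebra.spectralOrderedRing C
  refine ⟨_, hm.self_add_I_smul_cfcSqrt_sub_sq_mem_unitary m h1, ?_⟩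
  have hs : star (CFC.sqrt (1 - m ^ 2)) = CFC.sqrt (1 - m ^ 2) :=
    (CFC.sqrt_nonneg (1 - m ^ 2)).isSelfAdjoint
  rw [star_add, star_smul, hm.star_eq, hs,
    Complex.star_def, Complex.conj_I, neg_smul, two_smul]
  abel

/-! ### Contractivity of the multiplier action -/

section Multiplier

variable {A : Type*} [NonUnitalCStarAlgebra A] {B : Type*} [NonUnitalCStarAlgebra B]

theorem multiplier_fst_mul (m : 𝓜(ℂ, A)) (a b : A) : m.fst (a * b) = m.fst a * b := by
  have key : ∀ c : A, c * (m.fst (a * b) - m.fst a * b) = 0 := fun c => by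
    rw [mul_sub, ← mul_assoc, ← m.central, ← m.central, mul_assoc, sub_self]
  exact sub_eq_zero.1 (CStarRing.star_mul_self_eq_zero_iff _ |>.1 (key _))

theorem star_multiplier_fst_mul (m : 𝓜(ℂ, A)) (a b : A) :
    star (m.fst a) * m.fst b = star a * (star m * m).fst b := by
  rw [DoubleCentralizer.mul_fst, mul_apply_eq_comp, DoubleCentralizer.star_fst,
    ← star_mul, m.central, star_mul, star_star]

variable (A) in
/-- The action of the multipliers of `A` on `A`. -/
def multiplierEnd : 𝓜(ℂ, A) →ₐ[ℂ] Module.End ℂ A where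
  toFun m := (m.fst : A →ₗ[ℂ] A)
  map_one' := rfl
  map_mul' _ _ := rfl
  map_zero' := rfl
  map_add' _ _ := rfl
  commutes' _ := rfl

variable (A B) in
/-- The action of the multipliers of `A` on the first factor of `A ⊗ B`. -/
def multiplierMap : 𝓜(ℂ, A) →ₐ[ℂ] Module.End ℂ (A ⊗[ℂ] B) :=
  (Module.End.rTensorAlgHom ℂ A B).comp (multiplierEnd A)

@[simp]
theorem multiplierMap_tmul (m : 𝓜(ℂ, A)) (a : A) (b : B) :
    multiplierMap A B m (a ⊗ₜ b) = m.fst a ⊗ₜ b := rfl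

theorem star_multiplierMap_mul (m : 𝓜(ℂ, A)) (s t : A ⊗[ℂ] B) :
    star (multiplierMap A B m s) * multiplierMap A B m t =
      star s * multiplierMap A B (star m * m) t := by
  induction s using TensorProduct.induction_on with
  | zero => simp
  | add s₁ s₂ h₁ h₂ => simp only [map_add, star_add, add_mul, h₁, h₂]
  | tmul a b =>
    induction t using TensorProduct.induction_on with
    | zero => simp
    | add t₁ t₂ h₁ h₂ => simp only [map_add, mul_add, h₁, h₂]
    | tmul a' b' =>
      simp only [multiplierMap_tmul, TensorProduct.star_tmul,
        Algebra.TensorProduct.tmul_mul_tmul, star_multiplier_fst_mul]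

variable {p : Seminorm ℂ (A ⊗[ℂ] B)}

/-- `(u t)⋆ (u t) = t⋆ t`, so the C⋆-identity applies. -/
theorem IsCStarSeminorm.apply_multiplierMap_of_mem_unitary (hp : IsCStarSeminorm p)
    {u : 𝓜(ℂ, A)} (hu : u ∈ unitary 𝓜(ℂ, A)) (t : A ⊗[ℂ] B) :
    p (multiplierMap A B u t) = p t := by
  refine (sq_eq_sq₀ (apply_nonneg p _) (apply_nonneg p _)).1 ?_
  rw [← hp.star_mul_self, star_multiplierMap_mul, Unitary.star_mul_self_of_mem hu, map_one,
    Module.End.one_apply, hp.star_mul_self]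

theorem IsCStarSeminorm.apply_multiplierMap_le_of_isSelfAdjoint (hp : IsCStarSeminorm p)
    {m : 𝓜(ℂ, A)} (hm : IsSelfAdjoint m) (h1 : ‖m‖ ≤ 1) (t : A ⊗[ℂ] B) :
    p (multiplierMap A B m t) ≤ p t := by
  obtain ⟨u, hu', hu⟩ := exists_unitary_two_smul_eq_add_star hm h1
  have h : (2 : ℝ) * p (multiplierMap A B m t) ≤ p t + p t := by
    calc (2 : ℝ) * p (multiplierMap A B m t) = p (multiplierMap A B ((2 : ℂ) • m) t) := by
          rw [map_smul, LinearMap.smul_apply, map_smul_eq_mul]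
          simp
      _ ≤ _ := by
          rw [hu, map_add, LinearMap.add_apply]
          refine (map_add_le_add p _ _).trans_eq ?_
          rw [hp.apply_multiplierMap_of_mem_unitary hu',
            hp.apply_multiplierMap_of_mem_unitary (Unitary.star_mem hu')]
  linarith

/-- After normalising, `p (m t)² = p (t⋆ (m⋆m t)) ≤ p t * p (m⋆m t)`, and `m⋆m` is a self-adjoint
contraction, hence a mean of two unitaries. -/
theorem IsCStarSeminorm.apply_multiplierMap_le (hp : IsCStarSeminorm p) (m : 𝓜(ℂ, A))
    (t : A ⊗[ℂ] B) : p (multiplierMap A B m t) ≤ ‖m‖ * p t := by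
  wlog h1 : ‖m‖ = 1 generalizing m
  · rcases eq_or_ne m 0 with rfl | h0
    · simp
    have hn : ‖m‖ ≠ 0 := norm_ne_zero_iff.2 h0
    have h := this ((‖m‖⁻¹ : ℂ) • m) (by simp [norm_smul, hn])
    rw [map_smul, LinearMap.smul_apply, map_smul_eq_mul, norm_smul] at h
    have hi : ‖(‖m‖⁻¹ : ℂ)‖ = ‖m‖⁻¹ := by simp
    rw [hi, mul_assoc] at h
    exact le_of_mul_le_mul_left h (by positivity)
  rw [h1, one_mul]
  refine (sq_le_sq₀ (apply_nonneg p _) (apply_nonneg p _)).1 ?_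
  rw [← hp.star_mul_self, star_multiplierMap_mul, sq]
  refine (hp.mul_le _ _).trans ?_
  rw [hp.apply_star]
  gcongr
  exact hp.apply_multiplierMap_le_of_isSelfAdjoint (IsSelfAdjoint.star_mul_self m)
    (by simp [CStarRing.norm_star_mul_self, h1]) t

theorem IsCStarSeminorm.apply_mul_tmul_le (hp : IsCStarSeminorm p) (c a : A) (b : B) :
    p ((c * a) ⊗ₜ b) ≤ ‖c‖ * p (a ⊗ₜ b) := by
  have h := hp.apply_multiplierMap_le (c : 𝓜(ℂ, A)) (a ⊗ₜ b)
  have hc : ‖(c : 𝓜(ℂ, A))‖ ≤ ‖c‖ := by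
    rw [← DoubleCentralizer.norm_fst, DoubleCentralizer.coe_fst]
    exact ContinuousLinearMap.opNorm_mul_apply_le ℂ A c
  rw [multiplierMap_tmul, DoubleCentralizer.coe_fst] at h
  exact h.trans (mul_le_mul_of_nonneg_right hc (apply_nonneg p _))

theorem comm_mul (s t : B ⊗[ℂ] A) : TensorProduct.comm ℂ B A (s * t) =
    TensorProduct.comm ℂ B A s * TensorProduct.comm ℂ B A t := by
  induction s using TensorProduct.induction_on with
  | zero => simp
  | add s₁ s₂ h₁ h₂ => simp only [map_add, add_mul, h₁, h₂]
  | tmul a b =>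
    induction t using TensorProduct.induction_on with
    | zero => simp
    | add t₁ t₂ h₁ h₂ => simp only [map_add, mul_add, h₁, h₂]
    | tmul a' b' => simp

theorem comm_star (s : B ⊗[ℂ] A) :
    TensorProduct.comm ℂ B A (star s) = star (TensorProduct.comm ℂ B A s) := by
  induction s using TensorProduct.induction_on with
  | zero => simp
  | add s₁ s₂ h₁ h₂ => simp only [map_add, star_add, h₁, h₂]
  | tmul a b => simp

/-- Transfers estimates on the first factor to the second. -/
theorem IsCStarSeminorm.comp_comm (hp : IsCStarSeminorm p) :
    IsCStarSeminorm (p.comp (TensorProduct.comm ℂ B A).toLinearMap) where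
  mul_le s t := by simpa [comm_mul] using hp.mul_le _ _
  star_mul_self s := by simpa [comm_mul, comm_star] using hp.star_mul_self _

end Multiplier

/-! ### Localisation of the semi-norm over `X` -/

section

variable {X : Type*} [TopologicalSpace X] [CompactSpace X]
variable {A : Type*} [NonUnitalCStarAlgebra A] [CXAlgebra X A]

variable (X A) in
/-- The action of `C(X)` on a `C(X)`-algebra, as a homomorphism of algebras. -/
def actHom : C(X, ℂ) →ₐ[ℂ] Module.End ℂ A :=
  (multiplierEnd A).comp (CXAlgebra.structureMap : C(X, ℂ) →⋆ₐ[ℂ] 𝓜(ℂ, A)).toAlgHom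

theorem norm_structureMap_le (f : C(X, ℂ)) :
    ‖(CXAlgebra.structureMap f : 𝓜(ℂ, A))‖ ≤ ‖f‖ :=
  NonUnitalStarAlgHom.norm_apply_le _ f

theorem norm_act_le (f : C(X, ℂ)) (a : A) : ‖act f a‖ ≤ ‖f‖ * ‖a‖ := by
  refine ((CXAlgebra.structureMap f : 𝓜(ℂ, A)).fst.le_opNorm a).trans ?_
  rw [DoubleCentralizer.norm_fst]
  gcongr
  exact norm_structureMap_le f

theorem exists_isCutoffAt_norm_act_lt [T2Space X] {x : X} {d : A} (hd : d ∈ fibreIdeal A x)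
    {ε : ℝ} (hε : 0 < ε) : ∃ g : C(X, ℂ), IsCutoffAt x g ∧ ‖act g d‖ < ε := by
  let S := locallySmall (actHom X A) (normSeminorm ℂ A) norm_act_le x
  have hS : Submodule.span ℂ {c : A | ∃ f : C(X, ℂ), f x = 0 ∧ ∃ a : A, c = act f a} ≤ S := by
    rw [Submodule.span_le]
    rintro _ ⟨f, hf, a, rfl⟩
    exact apply_mem_locallySmall hf a
  have hdS : d ∈ S := mem_locallySmall_of_approx fun ε hε => by
    obtain ⟨c, hc, hdc⟩ := Metric.mem_closure_iff.1 hd ε hε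
    exact ⟨c, hS hc, by rwa [dist_eq_norm] at hdc⟩
  exact hdS ε hε

variable {B : Type*} [NonUnitalCStarAlgebra B]

variable (X A B) in
/-- The action of `C(X)` on the first factor of `A ⊗ B`. -/
def leftActHom : C(X, ℂ) →ₐ[ℂ] Module.End ℂ (A ⊗[ℂ] B) :=
  (multiplierMap A B).comp (CXAlgebra.structureMap : C(X, ℂ) →⋆ₐ[ℂ] 𝓜(ℂ, A)).toAlgHom

@[simp]
theorem leftActHom_tmul (f : C(X, ℂ)) (a : A) (b : B) :
    leftActHom X A B f (a ⊗ₜ b) = act f a ⊗ₜ b := rfl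

theorem leftActHom_mul_left (f : C(X, ℂ)) (s t : A ⊗[ℂ] B) :
    leftActHom X A B f (s * t) = leftActHom X A B f s * t := by
  induction s using TensorProduct.induction_on with
  | zero => simp
  | add s₁ s₂ h₁ h₂ => simp only [map_add, add_mul, h₁, h₂]
  | tmul a b =>
    induction t using TensorProduct.induction_on with
    | zero => simp
    | add t₁ t₂ h₁ h₂ => simp only [map_add, mul_add, h₁, h₂]
    | tmul a' b' => simp [act_mul]

theorem leftActHom_mul_right (f : C(X, ℂ)) (s t : A ⊗[ℂ] B) :
    leftActHom X A B f (s * t) = s * leftActHom X A B f t := by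
  induction s using TensorProduct.induction_on with
  | zero => simp
  | add s₁ s₂ h₁ h₂ => simp only [map_add, add_mul, h₁, h₂]
  | tmul a b =>
    induction t using TensorProduct.induction_on with
    | zero => simp
    | add t₁ t₂ h₁ h₂ => simp only [map_add, mul_add, h₁, h₂]
    | tmul a' b' => simp [mul_act]

variable {p : Seminorm ℂ (A ⊗[ℂ] B)}

theorem IsCStarSeminorm.apply_leftActHom_le (hp : IsCStarSeminorm p) (f : C(X, ℂ))
    (t : A ⊗[ℂ] B) : p (leftActHom X A B f t) ≤ ‖f‖ * p t :=
  (hp.apply_multiplierMap_le _ t).trans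
    (mul_le_mul_of_nonneg_right (norm_structureMap_le f) (apply_nonneg p t))

/-- Smallness of `‖g d‖` passes to `p` through the C⋆-identity: the square of `p (g d ⊗ b)` is `p
(g(g d)⋆ d ⊗ b⋆b)`, at most `‖g d‖ * p (d ⊗ b⋆b)`, whose last factor does not depend on `g`. -/
theorem IsCStarSeminorm.exists_isCutoffAt_act_tmul_lt [T2Space X] (hp : IsCStarSeminorm p)
    {x : X} {d : A} (hd : d ∈ fibreIdeal A x) (b : B) {ε : ℝ} (hε : 0 < ε) :
    ∃ g : C(X, ℂ), IsCutoffAt x g ∧ p (act g d ⊗ₜ b) < ε := by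
  have hq := apply_nonneg p (d ⊗ₜ (star b * b))
  obtain ⟨g, hg, hgd⟩ := exists_isCutoffAt_norm_act_lt hd
    (show 0 < ε ^ 2 / (p (d ⊗ₜ (star b * b)) + 1) by positivity)
  refine ⟨g, hg, lt_of_pow_lt_pow_left₀ 2 hε.le ?_⟩
  have h : star (act g d ⊗ₜ[ℂ] b) * act g d ⊗ₜ[ℂ] b =
      (act g (star (act g d)) * d) ⊗ₜ[ℂ] (star b * b) := by
    rw [TensorProduct.star_tmul, Algebra.TensorProduct.tmul_mul_tmul, ← act_mul, ← mul_act]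
  have hle : ‖act g (star (act g d))‖ ≤ ‖act g d‖ := by
    refine (norm_act_le _ _).trans ?_
    rw [norm_star]
    exact mul_le_of_le_one_left (norm_nonneg _) hg.norm_le
  rw [← hp.star_mul_self, h]
  calc _ ≤ ‖act g (star (act g d))‖ * p (d ⊗ₜ (star b * b)) := hp.apply_mul_tmul_le _ _ _
    _ ≤ ‖act g d‖ * (p (d ⊗ₜ (star b * b)) + 1) := by gcongr; linarith
    _ < ε ^ 2 := by rwa [← lt_div_iff₀ (by positivity)]

theorem IsCStarSeminorm.apply_iterate_mul_self_le (hp : IsCStarSeminorm p) (k : ℕ)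
    (t : A ⊗[ℂ] B) : p ((fun s => s * s)^[k] t) ≤ p t ^ 2 ^ k := by
  induction k generalizing t with
  | zero => simp
  | succ k ih =>
    rw [Function.iterate_succ_apply, pow_succ', pow_mul, sq]
    exact (ih _).trans (pow_le_pow_left₀ (apply_nonneg p _) (hp.mul_le t t) _)

theorem IsCStarSeminorm.apply_iterate_mul_self (hp : IsCStarSeminorm p) (k : ℕ)
    {t : A ⊗[ℂ] B} (ht : star t = t) : p ((fun s => s * s)^[k] t) = p t ^ 2 ^ k := by
  induction k generalizing t with
  | zero => simp
  | succ k ih =>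
    have h := hp.star_mul_self t
    rw [ht] at h
    rw [Function.iterate_succ_apply, pow_succ', pow_mul, ih (by rw [star_mul, ht]), h]

/-- Squaring replaces `g` by `g * g`, which `f` still absorbs; hence the induction generalises `g`.
-/
theorem leftActHom_iterate_mul_self {f g : C(X, ℂ)} (hfg : f * g = f) (k : ℕ) (t : A ⊗[ℂ] B) :
    leftActHom X A B f ((fun s => s * s)^[k] (leftActHom X A B g t)) =
      leftActHom X A B f ((fun s => s * s)^[k] t) := by
  induction k generalizing t g with
  | zero =>
    rw [Function.iterate_zero_apply, Function.iterate_zero_apply, ← Module.End.mul_apply,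
      ← map_mul, hfg]
  | succ k ih =>
    have h : leftActHom X A B g t * leftActHom X A B g t = leftActHom X A B (g * g) (t * t) := by
      rw [map_mul (leftActHom X A B), Module.End.mul_apply, leftActHom_mul_right,
        leftActHom_mul_left]
    rw [Function.iterate_succ_apply, Function.iterate_succ_apply, h,
      ih (by rw [← mul_assoc, hfg, hfg])]

theorem IsCStarSeminorm.apply_le_of_isCutoffAt [T2Space X] (hp : IsCStarSeminorm p)
    {t : A ⊗[ℂ] B} (ht : star t = t) {ε : ℝ} (hε : 0 < ε)
    (h : ∀ x : X, ∃ g : C(X, ℂ), IsCutoffAt x g ∧ p (leftActHom X A B g t) < ε) : p t ≤ ε := by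
  obtain ⟨s, f, g, hsum, hfg⟩ := exists_sum_eq_one_of_isCutoffAt
    {g : C(X, ℂ) | p (leftActHom X A B g t) < ε} fun x => (h x).imp fun g hg => ⟨hg.2, hg.1⟩
  have key : ∀ k : ℕ, p t ^ 2 ^ k ≤ s.card * ε ^ 2 ^ k := fun k => by
    have h₁ : (fun s => s * s)^[k] t =
        ∑ i, leftActHom X A B (f i) ((fun s => s * s)^[k] (leftActHom X A B (g i) t)) := by
      simp_rw [fun i => leftActHom_iterate_mul_self (hfg i).2.2 k t]
      rw [← LinearMap.sum_apply, ← map_sum, hsum, map_one, Module.End.one_apply]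
    rw [← hp.apply_iterate_mul_self k ht, h₁]
    refine (Finset.le_sum_of_subadditive p (map_zero p).le (map_add_le_add p) _ _).trans
      ((Finset.sum_le_card_nsmul _ _ (ε ^ 2 ^ k) ?_).trans_eq ?_)
    · intro i _
      refine (hp.apply_leftActHom_le _ _).trans
        ((mul_le_of_le_one_left (apply_nonneg p _) (hfg i).1).trans ?_)
      exact (hp.apply_iterate_mul_self_le k _).trans
        (pow_le_pow_left₀ (apply_nonneg p _) (hfg i).2.1.le _)
    · simp
  by_contra! hlt
  have hr : 1 < p t / ε := (one_lt_div hε).2 hlt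
  -- The number of terms is fixed while `(p t / ε) ^ 2 ^ k` is unbounded.
  obtain ⟨k, hk⟩ := pow_unbounded_of_one_lt (s.card : ℝ) hr
  have h₂ := hk.trans_le (pow_le_pow_right₀ hr.le k.lt_two_pow_self.le)
  rw [div_pow, lt_div_iff₀ (by positivity)] at h₂
  exact h₂.not_ge (key k)

variable [CXAlgebra X B]

theorem IsCStarSeminorm.exists_isCutoffAt_leftActHom_lt [T2Space X] (hp : IsCStarSeminorm p)
    (hI : ∀ α ∈ idealI X A B, p α = 0) {x : X} {α : A ⊗[ℂ] B} (hα : fibreMap A B x α = 0)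
    {ε : ℝ} (hε : 0 < ε) : ∃ g : C(X, ℂ), IsCutoffAt x g ∧ p (leftActHom X A B g α) < ε := by
  let S := locallySmall (leftActHom X A B) p hp.apply_leftActHom_le x
  suffices h : LinearMap.ker (fibreMap A B x) ≤ S from h hα ε hε
  -- Right exactness of `⊗` reduces the kernel to elementary tensors with one factor in a fibre
  -- ideal.
  rw [fibreMap, TensorProduct.map_ker
    (LinearMap.exact_subtype_mkQ (fibreIdeal A x)) (Submodule.mkQ_surjective _)
    (LinearMap.exact_subtype_mkQ (fibreIdeal B x)) (Submodule.mkQ_surjective _), sup_le_iff]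
  refine ⟨?_, ?_⟩
  · rintro _ ⟨t, rfl⟩
    induction t using TensorProduct.induction_on with
    | zero => simp
    | add t₁ t₂ h₁ h₂ => rw [map_add]; exact S.add_mem h₁ h₂
    | tmul a e =>
      intro ε hε
      obtain ⟨g, hg, hge⟩ := hp.comp_comm.exists_isCutoffAt_act_tmul_lt e.2 a hε
      refine ⟨g, hg, lt_of_le_of_lt ?_ hge⟩
      have h0 : p (act g a ⊗ₜ[ℂ] (e : B) - a ⊗ₜ[ℂ] act g (e : B)) = 0 :=
        hI _ (subset_involutiveIdealSpan _ ⟨g, a, e, rfl⟩)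
      have := map_add_le_add p (act g a ⊗ₜ[ℂ] (e : B) - a ⊗ₜ[ℂ] act g (e : B))
        (a ⊗ₜ[ℂ] act g (e : B))
      rw [sub_add_cancel, h0, zero_add] at this
      exact this
  · rintro _ ⟨t, rfl⟩
    induction t using TensorProduct.induction_on with
    | zero => simp
    | add t₁ t₂ h₁ h₂ => rw [map_add]; exact S.add_mem h₁ h₂
    | tmul d b => exact fun ε hε => hp.exists_isCutoffAt_act_tmul_lt d.2 b hε

end

end CXTensor

end

theorem mainTheorem5
    {X : Type*} [TopologicalSpace X] [CompactSpace X] [T2Space X]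
    {A : Type*} [NonUnitalCStarAlgebra A] [CXTensor.CXAlgebra X A]
    {B : Type*} [NonUnitalCStarAlgebra B] [CXTensor.CXAlgebra X B]
    (p : Seminorm ℂ (A ⊗[ℂ] B)) (hp : CXTensor.IsCStarSeminorm p)
    (hI : ∀ α ∈ CXTensor.idealI X A B, p α = 0) :
    ∀ α ∈ CXTensor.idealJ X A B, p α = 0 := by
  intro α hα
  -- The power estimate needs a self-adjoint element, and `star α * α` stays in the ideal `J`.
  have hsq : p (star α * α) = 0 :=
    le_antisymm (le_of_forall_pos_le_add fun ε hε => ?_) (apply_nonneg p _)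
  · rw [hp.star_mul_self] at hsq
    exact pow_eq_zero_iff two_ne_zero |>.1 hsq
  · rw [zero_add]
    refine hp.apply_le_of_isCutoffAt (X := X) (by rw [star_mul, star_star]) hε fun x => ?_
    exact hp.exists_isCutoffAt_leftActHom_lt hI ((CXTensor.mem_idealJ X A B).1
      ((CXTensor.idealJ_isInvolutiveIdeal X A B).mul_left _ _ hα) x) hε
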